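/- All graphs are finite, undirected and loopless, and may contain parallel edges. For a vertex set $X$ of $G$, $G[X]$ denotes the induced subgraph and $G-X$ the graph obtained by deleting $X$. A \emph{$K_4$-minor cover} of $G$ is a set $W\subseteq V(G)$ such that $G-W$ has no $K_4$ minor; given $S\subseteq V(G)$, it is \emph{disjoint} if $W\cap S=\emptyset$. A graph is \emph{biconnected} if it is connected and has no cut vertex (a vertex whose deletion strictly increases the number of connected components); a \emph{biconnected component} is a maximal biconnected subgraph. Let $G$ be a graph and let $S\subseteq V(G)$ be a $K_4$-minor cover of $G$ such that $G[S]$ has no $K_4$ minor. Put $F=V(G)\setminus S$, and suppose that the instance is \emph{independent}, i.e. (a) $F$ is an independent set; (b) every vertex of $F$ has exactly two neighbours in $S$; (c) for every vertex of $F$, its two neighbours in $S$ belong to a common biconnected component of $G[S]$; (d) $G[S\cup\{x\}]$ has no $K_4$ minor for every $x\in F$. Let $G^*(S)$ be the simple graph with vertex set $F$ in which distinct $u,v\in F$ are adjacent if and only if $G[S\cup\{u,v\}]$ has a $K_4$ minor. \textbf{Theorem.} A set $W\subseteq F$ is a disjoint $K_4$-minor cover of $G$ if and only if $W$ is a vertex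 cover of $G^*(S)$. -/

import Mathlib

/-!
Graphs are Mathlib's multigraphs `Graph α β`: parallel edges are allowed, and loops are excluded by
the class `Graph.Loopless`.  `G.induce X` is `G[X]` and `G.deleteVerts X` is `G - X`.
Connectedness is that of the underlying simple graph `G.toSimpleGraph` on the vertex set of `G`
(so a connected graph is nonempty).
-/

namespace Graph

/-- A cut vertex of `G`: a vertex whose deletion strictly increases the number of connected
components. -/
def IsCutVertex {α β : Type*} (G : Graph α β) (v : α) : Prop :=
  v ∈ G.vertexSet ∧
    ENat.card G.toSimpleGraph.ConnectedComponent <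
      ENat.card (G.deleteVerts {v}).toSimpleGraph.ConnectedComponent

/-- A graph is biconnected if it is connected and has no cut vertex. (In particular, a single
vertex and a single edge are biconnected.) -/
def IsBiconnected {α β : Type*} (G : Graph α β) : Prop :=
  G.toSimpleGraph.Connected ∧ ∀ v, ¬ G.IsCutVertex v

/-- `B` is a block (biconnected component) of `G`: a maximal biconnected subgraph of `G`. -/
def IsBlock {α β : Type*} (B G : Graph α β) : Prop :=
  Maximal (fun H : Graph α β => H ≤ G ∧ H.IsBiconnected) B

/-- The simple graph `H` is a minor of `G`: there are pairwise disjoint vertex sets of `G`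
(the branch sets), one for each vertex of `H`, each inducing a (nonempty) connected subgraph, such
that `G` has an edge between the branch sets of any two adjacent vertices of `H`. -/
def HasMinor {α β γ : Type*} (G : Graph α β) (H : SimpleGraph γ) : Prop :=
  ∃ B : γ → Set α,
    (∀ i, B i ⊆ G.vertexSet) ∧
    (∀ i, (G.induce (B i)).toSimpleGraph.Connected) ∧
    (∀ i j, i ≠ j → Disjoint (B i) (B j)) ∧
    (∀ i j, H.Adj i j → ∃ x ∈ B i, ∃ y ∈ B j, G.Adj x y)

/-- `G` contains `K₄` as a minor. -/
def HasK4Minor {α β : Type*} (G : Graph α β) : Prop :=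
  G.HasMinor (⊤ : SimpleGraph (Fin 4))

/-- A `K₄`-minor cover of `G`: a set of vertices whose deletion leaves a `K₄`-minor-free graph. -/
def IsK4MinorCover {α β : Type*} (G : Graph α β) (W : Set α) : Prop :=
  W ⊆ G.vertexSet ∧ ¬ (G.deleteVerts W).HasK4Minor

/-- A disjoint (that is, `S`-disjoint) `K₄`-minor cover of `G`. -/
def IsDisjointK4MinorCover {α β : Type*} (G : Graph α β) (S W : Set α) : Prop :=
  G.IsK4MinorCover W ∧ Disjoint W S

/-- `(G, S)` is an instance of the disjoint `K₄`-minor cover problem: `S` is a `K₄`-minor cover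
of `G`, and `G[S]` is itself `K₄`-minor-free. -/
structure IsDisjointInstance {α β : Type*} (G : Graph α β) (S : Set α) : Prop where
  cover : G.IsK4MinorCover S
  induce_free : ¬ (G.induce S).HasK4Minor

/-- `N_S(v)`, the set of neighbours of `v` that belong to `S`. -/
def neighborsIn {α β : Type*} (G : Graph α β) (S : Set α) (v : α) : Set α :=
  {s | s ∈ S ∧ G.Adj v s}

/-- An independent instance, where `F = V(G) \ S`. -/
structure IsIndependentInstance {α β : Type*} (G : Graph α β) (S : Set α) : Prop
    extends G.IsDisjointInstance S where
  /-- `F` is an independent set. -/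
  indep : ∀ u ∈ G.vertexSet \ S, ∀ v ∈ G.vertexSet \ S, ¬ G.Adj u v
  /-- Every vertex of `F` has exactly two neighbours in `S`. -/
  two_neighbors : ∀ v ∈ G.vertexSet \ S, (G.neighborsIn S v).ncard = 2
  /-- The neighbours of every vertex of `F` lie in a common biconnected component of `G[S]`. -/
  same_block : ∀ v ∈ G.vertexSet \ S,
    ∃ B : Graph α β, B.IsBlock (G.induce S) ∧ G.neighborsIn S v ⊆ B.vertexSet
  /-- `G[S ∪ {x}]` is `K₄`-minor-free for every `x` in `F`. -/
  single_free : ∀ x ∈ G.vertexSet \ S, ¬ (G.induce (S ∪ {x})).HasK4Minor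

/-- The auxiliary graph `G*(S)` on `F = V(G) \ S`: distinct `u` and `v` are adjacent iff
`G[S ∪ {u, v}]` has a `K₄` minor. -/
def auxGraph {α β : Type*} (G : Graph α β) (S : Set α) :
    SimpleGraph ↥(G.vertexSet \ S) where
  Adj u v := u ≠ v ∧ (G.induce (S ∪ {(u : α), (v : α)})).HasK4Minor
  symm := ⟨fun u v h => ⟨h.1.symm, by rw [Set.pair_comm]; exact h.2⟩⟩
  loopless := ⟨fun _ h => h.1 rfl⟩

end Graph

/-!
Only the adjacency graph `Γ` of `G` matters, and a `K₄` minor of an induced subgraph `G[X]` is a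
`K₄` model of `Γ` with branch sets inside `X` (`SimpleGraph.HasK4In`). Every vertex of `F` is an
*ear* over `S`: it has two neighbours `a`, `b` in `S`, and, since these share a block, no single
vertex separates them in `G[S]`. If `W` covers the edges of `G*(S)`, then any two ears outside `W`
are compatible, that is, adding both to `S` creates no `K₄` minor. The content of the theorem is
that pairwise compatible ears are jointly compatible (`SimpleGraph.IsEar.not_hasK4In_union`).

This follows by induction from the case of three ears `x`, `y`, `z`
(`SimpleGraph.IsEar.not_hasK4In_triple`): moving one ear into `S` keeps the remaining ones ears,
and keeps them pairwise compatible. For three ears, let `a`, `b` be the ends of `x`.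

* The ear `x` can be exchanged for a virtual edge `ab`. Since `K₄` is 3-connected, a `K₄` model in
  a graph with a 2-separation along an edge `ab` lives on one side of it
  (`SimpleGraph.HasK4In.two_sum`). Conversely, a virtual edge in a `K₄` model can be replaced by any
  connected set adjacent to `a` and `b` and disjoint from the model
  (`SimpleGraph.HasK4In.replace_edge`).
* The ends of `y` do not lie in different components of `S \ {a, b}`: two such components joined by
  `y`, together with `a` and `b` joined by `x`, would form a `K₄` model
  (`SimpleGraph.IsEar.mem_side`). The same holds for `z`.
* If `y` and `z` attach to different sides, each side involves only two of the three ears. If both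
  attach to the same component `D`, then `a` and `b` are also linked outside `D`, by an edge or by a
  connected set (`SimpleGraph.IsEar.exists_other_side`, which rests on Menger's theorem for two
  connections), and this link replaces `x`. Either way, a `K₄` model with three ears yields one
  with two.
-/

namespace SimpleGraph

variable {α : Type*} {Γ : SimpleGraph α}

/-! ### Connected vertex sets -/

/-- `Z` induces a connected subgraph of `Γ`: it is nonempty, and every nonempty subset of `Z`
closed under adjacency within `Z` is all of `Z`. This form avoids walks and subtypes. -/
def IsConnSet (Γ : SimpleGraph α) (Z : Set α) : Prop :=
  Z.Nonempty ∧ ∀ T ⊆ Z, T.Nonempty → (∀ u ∈ T, ∀ v ∈ Z, Γ.Adj u v → v ∈ T) → Z ⊆ T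

namespace IsConnSet

lemma singleton (x : α) : Γ.IsConnSet {x} := by
  refine ⟨⟨x, rfl⟩, fun T hT ⟨t, ht⟩ _ => ?_⟩
  have : t = x := hT ht
  grind

lemma union {X Y : Set α} (hX : Γ.IsConnSet X) (hY : Γ.IsConnSet Y) {p : α} (hpX : p ∈ X)
    (hpY : p ∈ Y) : Γ.IsConnSet (X ∪ Y) := by
  refine ⟨⟨p, Or.inl hpX⟩, fun T hT ⟨t, ht⟩ hcl => ?_⟩
  have key : ∀ {X' : Set α}, X' ⊆ X ∪ Y → Γ.IsConnSet X' → (T ∩ X').Nonempty → X' ⊆ T :=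
    fun {X'} hX' hc hn => (hc.2 (T ∩ X') Set.inter_subset_right hn
      fun u hu v hv huv => ⟨hcl u hu.1 v (hX' hv) huv, hv⟩).trans Set.inter_subset_left
  have hpT : p ∈ T := by
    rcases hT ht with h | h
    · exact key Set.subset_union_left hX ⟨t, ht, h⟩ hpX
    · exact key Set.subset_union_right hY ⟨t, ht, h⟩ hpY
  exact Set.union_subset (key Set.subset_union_left hX ⟨p, hpT, hpX⟩)
    (key Set.subset_union_right hY ⟨p, hpT, hpY⟩)

lemma pair {x y : α} (h : Γ.Adj x y) : Γ.IsConnSet {x, y} := by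
  refine ⟨⟨x, Or.inl rfl⟩, fun T hT ⟨t, ht⟩ hcl => ?_⟩
  rcases hT ht with rfl | ht'
  · have := hcl t ht y (Or.inr rfl) h
    grind
  · obtain rfl : t = y := ht'
    have := hcl t ht x (Or.inl rfl) h.symm
    grind

lemma insert {X : Set α} (hX : Γ.IsConnSet X) {u v : α} (hu : u ∈ X) (h : Γ.Adj u v) :
    Γ.IsConnSet (insert v X) := by
  have := hX.union (pair h) hu (Or.inl rfl)
  rwa [show X ∪ {u, v} = Insert.insert v X by grind] at this

/-- A proper nonempty part of a connected set has an edge leaving it. -/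
lemma exists_adj {Z T : Set α} (hZ : Γ.IsConnSet Z) (hT : T ⊆ Z) (hne : T.Nonempty) {w : α}
    (hw : w ∈ Z) (hwT : w ∉ T) : ∃ u ∈ T, ∃ v ∈ Z, v ∉ T ∧ Γ.Adj u v := by
  by_contra! h
  exact hwT (hZ.2 T hT hne (fun u hu v hv huv => by_contra fun hvT => h u hu v hv hvT huv) hw)

/-- Every vertex of `Z` lies in a connected component of the subgraph induced by `Z`. -/
lemma exists_component {Z : Set α} {p : α} (hp : p ∈ Z) :
    ∃ C ⊆ Z, p ∈ C ∧ Γ.IsConnSet C ∧ ∀ u ∈ C, ∀ v ∈ Z, Γ.Adj u v → v ∈ C := by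
  refine ⟨{v | ∃ T ⊆ Z, Γ.IsConnSet T ∧ p ∈ T ∧ v ∈ T}, ?_, ?_, ⟨?_, ?_⟩, ?_⟩
  · rintro v ⟨T, hT, -, -, hv⟩
    exact hT hv
  · exact ⟨{p}, by simpa, singleton p, rfl, rfl⟩
  · exact ⟨p, {p}, by simpa, singleton p, rfl, rfl⟩
  · rintro R hR ⟨r, hr⟩ hcl
    have key : ∀ T ⊆ Z, Γ.IsConnSet T → p ∈ T → (R ∩ T).Nonempty → T ⊆ R :=
      fun T hT hc hpT hn => (hc.2 (R ∩ T) Set.inter_subset_right hn fun u hu v hv huv =>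
        ⟨hcl u hu.1 v ⟨T, hT, hc, hpT, hv⟩ huv, hv⟩).trans Set.inter_subset_left
    obtain ⟨T, hT, hc, hpT, hrT⟩ := hR hr
    have hpR := key T hT hc hpT ⟨r, hr, hrT⟩ hpT
    rintro v ⟨T', hT', hc', hpT', hvT'⟩
    exact key T' hT' hc' hpT' ⟨p, hpR, hpT'⟩ hvT'
  · rintro u ⟨T, hT, hc, hpT, huT⟩ v hv huv
    exact ⟨_, Set.insert_subset hv hT, hc.insert huT huv, Or.inr hpT, Or.inl rfl⟩

/-- A connected set inside `Z` that meets a component `C` of `Z` lies in `C`. -/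
lemma subset_of_closed {Z C T : Set α} (hT : Γ.IsConnSet T) (hTZ : T ⊆ Z)
    (hC : ∀ u ∈ C, ∀ v ∈ Z, Γ.Adj u v → v ∈ C) {p : α} (hpT : p ∈ T) (hpC : p ∈ C) : T ⊆ C :=
  (hT.2 (C ∩ T) Set.inter_subset_right ⟨p, hpC, hpT⟩ fun u hu v hv huv =>
    ⟨hC u hu.1 v (hTZ hv) huv, hv⟩).trans Set.inter_subset_left

/-- The inner part of an `a`–`b` path: in a connected set containing two nonadjacent vertices,
some connected set avoiding both of them has neighbours of both. -/
lemma exists_interior {Z : Set α} (hZ : Γ.IsConnSet Z) {a b : α} (ha : a ∈ Z) (hb : b ∈ Z)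
    (hne : a ≠ b) (hab : ¬ Γ.Adj a b) :
    ∃ T ⊆ Z \ {a, b}, Γ.IsConnSet T ∧ (∃ u ∈ T, Γ.Adj a u) ∧ ∃ v ∈ T, Γ.Adj b v := by
  by_contra! H
  -- `R` consists of `a` and the components of `Z \ {a, b}` adjacent to `a`.
  set R : Set α := {v | v = a ∨ ∃ T ⊆ Z \ {a, b}, Γ.IsConnSet T ∧ v ∈ T ∧ ∃ u ∈ T, Γ.Adj a u}
  have hR : R ⊆ Z := by
    rintro v (rfl | ⟨T, hT, -, hv, -⟩)
    · exact ha
    · exact (hT hv).1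
  have hbR : b ∉ R := by
    rintro (h | ⟨T, hT, -, hv, -⟩)
    · exact hne h.symm
    · exact (hT hv).2 (Or.inr rfl)
  obtain ⟨u, hu, v, hv, hvR, huv⟩ := hZ.exists_adj hR ⟨a, Or.inl rfl⟩ hb hbR
  have hva : v ≠ a := fun h => hvR (Or.inl h)
  rcases hu with rfl | ⟨T, hT, hc, huT, w, hw, haw⟩
  · have hvb : v ≠ b := fun h => hab (h ▸ huv)
    exact hvR (Or.inr ⟨{v}, by grind, singleton v, rfl, v, rfl, huv⟩)
  · by_cases hvb : v = b
    · subst hvb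
      exact H T hT hc ⟨w, hw, haw⟩ u huT huv.symm
    · exact hvR (Or.inr ⟨_, Set.insert_subset ⟨hv, by grind⟩ hT, hc.insert huT huv, Or.inl rfl,
        w, Or.inr hw, haw⟩)

end IsConnSet

/-! ### Two disjoint connections -/

/-- One half of the separator step: if `{u, v}` separates `A` from `B` in `C`, then the part of `C`
on the side of `A` contains two disjoint connected sets joining `A` to `u` and to `v`. The
hypothesis `ih` is two-connection Menger for proper subsets of `C`. -/
lemma exists_disjoint_to_separator {C A B : Set α}
    (ih : ∀ C' ⊂ C, ∀ B' : Set α,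
      (∀ c, ∃ Z ⊆ C', c ∉ Z ∧ Γ.IsConnSet Z ∧ (Z ∩ A).Nonempty ∧ (Z ∩ B').Nonempty) →
      ∃ X ⊆ C', ∃ Y ⊆ C', Disjoint X Y ∧ Γ.IsConnSet X ∧ Γ.IsConnSet Y ∧
        (X ∩ A).Nonempty ∧ (Y ∩ A).Nonempty ∧ (X ∩ B').Nonempty ∧ (Y ∩ B').Nonempty)
    (h : ∀ c, ∃ Z ⊆ C, c ∉ Z ∧ Γ.IsConnSet Z ∧ (Z ∩ A).Nonempty ∧ (Z ∩ B).Nonempty)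
    {u v : α} (hu : u ∈ C) (hv : v ∈ C) (hvB : v ∉ B)
    (hsep : ∀ Z ⊆ C, u ∉ Z → v ∉ Z → Γ.IsConnSet Z → (Z ∩ A).Nonempty → ¬ (Z ∩ B).Nonempty)
    {L : Set α}
    (hL : L = {w | ∃ Z ⊆ C, u ∉ Z ∧ v ∉ Z ∧ Γ.IsConnSet Z ∧ w ∈ Z ∧ (Z ∩ A).Nonempty}) :
    ∃ X ⊆ {u, v} ∪ L, ∃ Y ⊆ {u, v} ∪ L, Disjoint X Y ∧ Γ.IsConnSet X ∧ Γ.IsConnSet Y ∧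
        (X ∩ A).Nonempty ∧ (Y ∩ A).Nonempty ∧ u ∈ X ∧ v ∈ Y := by
  have hLC : L ⊆ C := by
    subst hL
    rintro w ⟨Z, hZ, -, -, -, hw, -⟩
    exact hZ hw
  have hss : {u, v} ∪ L ⊂ C := by
    refine ⟨by grind, fun hCL => ?_⟩
    obtain ⟨Z, hZC, huZ, hZ, -, b, hbZ, hbB⟩ := h u
    have hbv : b ≠ v := fun h => hvB (h ▸ hbB)
    have hbu : b ≠ u := fun h => huZ (h ▸ hbZ)
    have hbL : b ∈ L := by grind
    rw [hL] at hbL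
    obtain ⟨Z', hZ', h1, h2, h3, h4, h5⟩ := hbL
    exact hsep Z' hZ' h1 h2 h3 h5 ⟨b, h4, hbB⟩
  obtain ⟨X, hX, Y, hY, hd, hcX, hcY, hXA, hYA, ⟨p, hpX, hp⟩, ⟨q, hqY, hq⟩⟩ :=
    ih _ hss {u, v} fun c => by
      obtain ⟨Z, hZC, hcZ, hZ, ⟨a, haZ, haA⟩, hZB⟩ := h c
      by_cases ha : a = u ∨ a = v
      · exact ⟨{a}, by grind, by grind, .singleton a, ⟨a, rfl, haA⟩, ⟨a, rfl, ha⟩⟩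
      -- Walk in `Z` from `a` until the first vertex of `{u, v}`.
      · obtain ⟨K, hKZ, haK, hK, hKcl⟩ :=
          IsConnSet.exists_component (Γ := Γ) (Z := Z \ {u, v}) (p := a) (by grind)
        have hKL : K ⊆ L := by
          rw [hL]
          exact fun w hw => ⟨K, by grind, by grind, by grind, hK, hw, a, haK, haA⟩
        obtain ⟨z, hzZ, hz⟩ : ∃ z ∈ Z, z = u ∨ z = v := by
          by_contra! hno
          exact hsep Z hZC (fun hh => (hno u hh).1 rfl) (fun hh => (hno v hh).2 rfl) hZ
            ⟨a, haZ, haA⟩ hZB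
        obtain ⟨s, hs, t, ht, htK, hst⟩ :=
          hZ.exists_adj (T := K) (by grind) ⟨a, haK⟩ hzZ (by grind)
        have htuv : t = u ∨ t = v := by
          by_contra htuv
          exact htK (hKcl s hs t ⟨ht, htuv⟩ hst)
        exact ⟨_, (Set.insert_subset_iff.2 ⟨Or.inl htuv, fun w hw => Or.inr (hKL hw)⟩),
          by grind, hK.insert hs hst, ⟨a, Or.inr haK, haA⟩, ⟨t, Or.inl rfl, htuv⟩⟩
  have hpq : p ≠ q := fun hpq => Set.disjoint_left.1 hd hpX (hpq ▸ hqY)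
  rcases hp with rfl | hp
  · have hq' : q = v := by grind
    exact ⟨X, hX, Y, hY, hd, hcX, hcY, hXA, hYA, hpX, hq' ▸ hqY⟩
  · have hp' : p = v := hp
    have hq' : q = u := by grind
    exact ⟨Y, hY, X, hX, hd.symm, hcY, hcX, hYA, hXA, hq' ▸ hqY, hp' ▸ hpX⟩

/-- Menger's theorem for two connections: if no single vertex separates `A` from `B` in the finite
set `C`, then `C` contains two disjoint connected sets, each meeting both `A` and `B`. (Over an
empty vertex type the hypothesis would be vacuous.) -/
theorem exists_disjoint_connections [Nonempty α] {C : Set α} (hC : C.Finite) (A B : Set α)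
    (h : ∀ c, ∃ Z ⊆ C, c ∉ Z ∧ Γ.IsConnSet Z ∧ (Z ∩ A).Nonempty ∧ (Z ∩ B).Nonempty) :
    ∃ X ⊆ C, ∃ Y ⊆ C, Disjoint X Y ∧ Γ.IsConnSet X ∧ Γ.IsConnSet Y ∧
      (X ∩ A).Nonempty ∧ (Y ∩ A).Nonempty ∧ (X ∩ B).Nonempty ∧ (Y ∩ B).Nonempty := by
  induction hn : C.ncard using Nat.strong_induction_on generalizing C A B with
  | _ n ih =>
  subst hn
  have ih' : ∀ C' ⊂ C, ∀ A B : Set α,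
      (∀ c, ∃ Z ⊆ C', c ∉ Z ∧ Γ.IsConnSet Z ∧ (Z ∩ A).Nonempty ∧ (Z ∩ B).Nonempty) →
      ∃ X ⊆ C', ∃ Y ⊆ C', Disjoint X Y ∧ Γ.IsConnSet X ∧ Γ.IsConnSet Y ∧
        (X ∩ A).Nonempty ∧ (Y ∩ A).Nonempty ∧ (X ∩ B).Nonempty ∧ (Y ∩ B).Nonempty :=
    fun C' hC' A B h => ih _ (Set.ncard_lt_ncard hC' hC) (hC.subset hC'.1) A B h rfl
  by_cases h1 : ∃ x ∈ C, x ∈ A ∧ x ∈ B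
  · obtain ⟨x, hx, hxA, hxB⟩ := h1
    obtain ⟨Z, hZC, hxZ, hZ, hZA, hZB⟩ := h x
    exact ⟨{x}, by simpa, Z, hZC, by simpa, .singleton x, hZ, ⟨x, rfl, hxA⟩, hZA, ⟨x, rfl, hxB⟩,
      hZB⟩
  by_cases h2 : ∃ v ∈ C, v ∉ A ∧ v ∉ B
  · obtain ⟨v, hv, hvA, hvB⟩ := h2
    have hss : C \ {v} ⊂ C := ⟨Set.sdiff_subset, fun hh => (hh hv).2 rfl⟩
    by_cases h3 : ∀ c, ∃ Z ⊆ C \ {v}, c ∉ Z ∧ Γ.IsConnSet Z ∧ (Z ∩ A).Nonempty ∧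
        (Z ∩ B).Nonempty
    · obtain ⟨X, hX, Y, hY, hrest⟩ := ih' _ hss A B h3
      exact ⟨X, hX.trans Set.sdiff_subset, Y, hY.trans Set.sdiff_subset, hrest⟩
    -- Now `{u, v}` separates `A` from `B`, and connections are glued at `u` and at `v`.
    push Not at h3
    obtain ⟨u, hu⟩ := h3
    have hsep : ∀ Z ⊆ C, u ∉ Z → v ∉ Z → Γ.IsConnSet Z → (Z ∩ A).Nonempty →
        ¬ (Z ∩ B).Nonempty := fun Z hZ huZ hvZ hc hA hB => by
      have hZv : Z ⊆ C \ {v} := fun w hw => ⟨hZ hw, fun hwv => hvZ (hwv ▸ hw)⟩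
      exact hB.ne_empty (hu Z hZv huZ hc hA)
    have huC : u ∈ C := by
      obtain ⟨Z, hZC, hvZ, hZ, hZA, hZB⟩ := h v
      by_contra huC
      exact hsep Z hZC (fun hh => huC (hZC hh)) hvZ hZ hZA hZB
    obtain ⟨X, hX, Y, hY, hd, hcX, hcY, hXA, hYA, huX, hvY⟩ :=
      exists_disjoint_to_separator (fun C' hC' B' => ih' C' hC' A B') h huC hv hvB hsep rfl
    obtain ⟨X', hX', Y', hY', hd', hcX', hcY', hXB, hYB, huX', hvY'⟩ :=
      exists_disjoint_to_separator (fun C' hC' B' => ih' C' hC' B B')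
        (fun c => by obtain ⟨Z, h1, h2, h3, h4, h5⟩ := h c; exact ⟨Z, h1, h2, h3, h5, h4⟩)
        huC hv hvA (fun Z h1 h2 h3 h4 h5 h6 => hsep Z h1 h2 h3 h4 h6 h5) rfl
    have hLC : ∀ A : Set α, {w | ∃ Z ⊆ C, u ∉ Z ∧ v ∉ Z ∧ Γ.IsConnSet Z ∧ w ∈ Z ∧
        (Z ∩ A).Nonempty} ⊆ C := by
      rintro A w ⟨Z, hZ, -, -, -, hw, -⟩
      exact hZ hw
    have hLR : ∀ w, w ∈ {w | ∃ Z ⊆ C, u ∉ Z ∧ v ∉ Z ∧ Γ.IsConnSet Z ∧ w ∈ Z ∧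
        (Z ∩ A).Nonempty} → w ∉ {w | ∃ Z ⊆ C, u ∉ Z ∧ v ∉ Z ∧ Γ.IsConnSet Z ∧ w ∈ Z ∧
        (Z ∩ B).Nonempty} := by
      rintro w ⟨Z, hZ, h1, h2, h3, h4, a, haZ, haA⟩ ⟨Z', hZ', h1', h2', h3', h4', b, hbZ, hbB⟩
      exact hsep (Z ∪ Z') (Set.union_subset hZ hZ') (by grind) (by grind) (h3.union h3' h4 h4')
        ⟨a, Or.inl haZ, haA⟩ ⟨b, Or.inr hbZ, hbB⟩
    have hXC : {u, v} ∪ {w | ∃ Z ⊆ C, u ∉ Z ∧ v ∉ Z ∧ Γ.IsConnSet Z ∧ w ∈ Z ∧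
        (Z ∩ A).Nonempty} ⊆ C := Set.union_subset (Set.pair_subset huC hv) (hLC A)
    have hXC' : {u, v} ∪ {w | ∃ Z ⊆ C, u ∉ Z ∧ v ∉ Z ∧ Γ.IsConnSet Z ∧ w ∈ Z ∧
        (Z ∩ B).Nonempty} ⊆ C := Set.union_subset (Set.pair_subset huC hv) (hLC B)
    refine ⟨X ∪ X', Set.union_subset (hX.trans hXC) (hX'.trans hXC'),
      Y ∪ Y', Set.union_subset (hY.trans hXC) (hY'.trans hXC'), ?_, hcX.union hcX' huX huX',
      hcY.union hcY' hvY hvY', hXA.mono (by gcongr; exact Set.subset_union_left),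
      hYA.mono (by gcongr; exact Set.subset_union_left),
      hXB.mono (by gcongr; exact Set.subset_union_right),
      hYB.mono (by gcongr; exact Set.subset_union_right)⟩
    rw [Set.disjoint_left] at hd hd' ⊢
    rintro w (hw | hw) (hw' | hw')
    · exact hd hw hw'
    · rcases hX hw with (rfl | rfl) | hwL
      · exact hd' huX' hw'
      · exact hd hw hvY
      rcases hY' hw' with (rfl | rfl) | hwR
      · exact hd' huX' hw'
      · exact hd hw hvY
      · exact hLR w hwL hwR
    · rcases hX' hw with (rfl | rfl) | hwR
      · exact hd huX hw'
      · exact hd' hw hvY'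
      rcases hY hw' with (rfl | rfl) | hwL
      · exact hd huX hw'
      · exact hd' hw hvY'
      · exact hLR w hwL hwR
    · exact hd' hw hw'
  · -- `A` and `B` partition `C`, so the claim is about a matching of size two between them.
    have hedge : ∀ c, ∃ a ∈ C, ∃ b ∈ C, a ∈ A ∧ b ∈ B ∧ a ≠ c ∧ b ≠ c ∧ Γ.Adj a b := by
      intro c
      obtain ⟨Z, hZC, hcZ, hZ, ⟨a, haZ, haA⟩, ⟨b, hbZ, hbB⟩⟩ := h c
      obtain ⟨s, hs, t, ht, htA, hst⟩ := hZ.exists_adj (T := Z ∩ A) Set.inter_subset_left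
        ⟨a, haZ, haA⟩ hbZ (fun hh => h1 ⟨b, hZC hbZ, hh.2, hbB⟩)
      exact ⟨s, hZC hs.1, t, hZC ht, hs.2, by grind, by grind, by grind, hst⟩
    have fin : ∀ a ∈ C, ∀ b ∈ C, ∀ a' ∈ C, ∀ b' ∈ C, a ∈ A → b ∈ B → a' ∈ A → b' ∈ B →
        Γ.Adj a b → Γ.Adj a' b' → a ≠ a' → b ≠ b' →
        ∃ X ⊆ C, ∃ Y ⊆ C, Disjoint X Y ∧ Γ.IsConnSet X ∧ Γ.IsConnSet Y ∧
          (X ∩ A).Nonempty ∧ (Y ∩ A).Nonempty ∧ (X ∩ B).Nonempty ∧ (Y ∩ B).Nonempty := by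
      intro a ha b hb a' ha' b' hb' haA hbB haA' hbB' hab hab' hne hne'
      have hn : ∀ x ∈ C, x ∈ A → x ∉ B := fun x hx hA hB => h1 ⟨x, hx, hA, hB⟩
      have hn₁ := hn a ha haA
      have hn₂ := hn a' ha' haA'
      refine ⟨{a, b}, by grind, {a', b'}, by grind, ?_, .pair hab, .pair hab',
        ⟨a, by simp, haA⟩, ⟨a', by simp, haA'⟩, ⟨b, by simp, hbB⟩, ⟨b', by simp, hbB'⟩⟩
      rw [Set.disjoint_left]
      clear ih ih' h h1 h2 hedge
      grind
    obtain ⟨a₁, ha₁, b₁, hb₁, hA₁, hB₁, -, -, e₁⟩ := hedge (Classical.arbitrary α)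
    obtain ⟨a₂, ha₂, b₂, hb₂, hA₂, hB₂, hne₂, -, e₂⟩ := hedge a₁
    by_cases hb : b₂ = b₁
    · obtain ⟨a₃, ha₃, b₃, hb₃, hA₃, hB₃, -, hne₃, e₃⟩ := hedge b₁
      by_cases ha : a₃ = a₁
      · exact fin a₂ ha₂ b₂ hb₂ a₃ ha₃ b₃ hb₃ hA₂ hB₂ hA₃ hB₃ e₂ e₃ (by grind) (by grind)
      · exact fin a₁ ha₁ b₁ hb₁ a₃ ha₃ b₃ hb₃ hA₁ hB₁ hA₃ hB₃ e₁ e₃ (by grind) (by grind)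
    · exact fin a₁ ha₁ b₁ hb₁ a₂ ha₂ b₂ hb₂ hA₁ hB₁ hA₂ hB₂ e₁ e₂ (by grind) (by grind)

variable {Γ' : SimpleGraph α}

lemma IsConnSet.mono (hΓ : Γ ≤ Γ') {Z : Set α} (hZ : Γ.IsConnSet Z) : Γ'.IsConnSet Z :=
  ⟨hZ.1, fun T hT hne hcl => hZ.2 T hT hne fun u hu v hv huv => hcl u hu v hv (hΓ huv)⟩

/-! ### `K₄` models inside a vertex set -/

/-- `X` contains the branch sets of a `K₄` model of `Γ`; equivalently, the subgraph of `Γ` induced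
by `X` has a `K₄` minor. -/
def HasK4In (Γ : SimpleGraph α) (X : Set α) : Prop :=
  ∃ B : Fin 4 → Set α, (∀ i, B i ⊆ X) ∧ (∀ i, Γ.IsConnSet (B i)) ∧
    (∀ i j, i ≠ j → Disjoint (B i) (B j)) ∧ ∀ i j, i ≠ j → ∃ x ∈ B i, ∃ y ∈ B j, Γ.Adj x y

namespace HasK4In

lemma mono_set {X Y : Set α} (hXY : X ⊆ Y) (h : Γ.HasK4In X) : Γ.HasK4In Y := by
  obtain ⟨B, hB, hrest⟩ := h
  exact ⟨B, fun i => (hB i).trans hXY, hrest⟩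

lemma mono_graph (hΓ : Γ ≤ Γ') {X : Set α} (h : Γ.HasK4In X) : Γ'.HasK4In X := by
  obtain ⟨B, hB, hc, hd, hadj⟩ := h
  refine ⟨B, hB, fun i => (hc i).mono hΓ, hd, fun i j hij => ?_⟩
  obtain ⟨x, hx, y, hy, hxy⟩ := hadj i j hij
  exact ⟨x, hx, y, hy, hΓ hxy⟩

/-- A `K₄` model given by four explicit branch sets. -/
lemma of_sets {X P Q R T : Set α} (hP : P ⊆ X) (hQ : Q ⊆ X) (hR : R ⊆ X) (hT : T ⊆ X)
    (cP : Γ.IsConnSet P) (cQ : Γ.IsConnSet Q) (cR : Γ.IsConnSet R) (cT : Γ.IsConnSet T)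
    (dPQ : Disjoint P Q) (dPR : Disjoint P R) (dPT : Disjoint P T) (dQR : Disjoint Q R)
    (dQT : Disjoint Q T) (dRT : Disjoint R T)
    (aPQ : ∃ x ∈ P, ∃ y ∈ Q, Γ.Adj x y) (aPR : ∃ x ∈ P, ∃ y ∈ R, Γ.Adj x y)
    (aPT : ∃ x ∈ P, ∃ y ∈ T, Γ.Adj x y) (aQR : ∃ x ∈ Q, ∃ y ∈ R, Γ.Adj x y)
    (aQT : ∃ x ∈ Q, ∃ y ∈ T, Γ.Adj x y) (aRT : ∃ x ∈ R, ∃ y ∈ T, Γ.Adj x y) :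
    Γ.HasK4In X := by
  have sym : ∀ {U V : Set α}, (∃ x ∈ U, ∃ y ∈ V, Γ.Adj x y) → ∃ x ∈ V, ∃ y ∈ U, Γ.Adj x y :=
    fun ⟨x, hx, y, hy, h⟩ => ⟨y, hy, x, hx, h.symm⟩
  refine ⟨![P, Q, R, T], ?_, ?_, ?_, ?_⟩
  · intro i
    fin_cases i <;> assumption
  · intro i
    fin_cases i <;> assumption
  · intro i j hij
    fin_cases i <;> fin_cases j <;>
      first | exact absurd rfl hij | assumption | (apply Disjoint.symm; assumption)
  · intro i j hij
    fin_cases i <;> fin_cases j <;>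
      first | exact absurd rfl hij | assumption | (apply sym; assumption)

lemma not_triple (x y z : α) : ¬ Γ.HasK4In {x, y, z} := by
  rintro ⟨B, hB, hc, hd, -⟩
  choose p hp using fun i => (hc i).1
  have hinj : Function.Injective p := fun i j hij => by
    by_contra hne
    exact Set.disjoint_left.1 (hd i j hne) (hp i) (hij ▸ hp j)
  have h1 : (Set.range p).ncard = 4 := by
    rw [← Set.image_univ, Set.ncard_image_of_injective _ hinj, Set.ncard_univ]
    simp
  have h2 : (Set.range p).ncard ≤ ({x, y, z} : Set α).ncard :=
    Set.ncard_le_ncard (by rintro _ ⟨i, rfl⟩; exact hB i (hp i)) (by simp)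
  have h3 : ({x, y, z} : Set α).ncard ≤ 3 := by
    refine (Set.ncard_insert_le _ _).trans ?_
    have := Set.ncard_insert_le y {z}
    simp at this
    omega
  omega

/-- Restricting a `K₄` model to one side of the 2-separation given by an edge `ab`, when every
branch set avoiding `a` and `b` lies on that side. -/
lemma restrict_side {D D' : Set α} {a b : α} (hab : Γ.Adj a b)
    (hD : ∀ u ∈ D, ∀ v ∈ D', ¬ Γ.Adj u v) (hdis : Disjoint ({a, b} ∪ D) D') {B : Fin 4 → Set α}
    (hB : ∀ i, B i ⊆ {a, b} ∪ (D ∪ D')) (hc : ∀ i, Γ.IsConnSet (B i))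
    (hd : ∀ i j, i ≠ j → Disjoint (B i) (B j))
    (hadj : ∀ i j, i ≠ j → ∃ x ∈ B i, ∃ y ∈ B j, Γ.Adj x y)
    (hside : ∀ i, a ∉ B i → b ∉ B i → B i ⊆ D) : Γ.HasK4In ({a, b} ∪ D) := by
  rw [Set.disjoint_left] at hdis
  refine ⟨fun i => B i ∩ ({a, b} ∪ D), fun i => Set.inter_subset_right, fun i => ?_,
    fun i j hij => (hd i j hij).mono Set.inter_subset_left Set.inter_subset_left,
    fun i j hij => ?_⟩
  · by_cases hi : a ∉ B i ∧ b ∉ B i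
    · have := hside i hi.1 hi.2
      simp only [Set.inter_eq_left.2 (this.trans Set.subset_union_right)]
      exact hc i
    have hmeet : a ∈ B i ∨ b ∈ B i := by
      by_contra hno
      exact hi ⟨fun h => hno (Or.inl h), fun h => hno (Or.inr h)⟩
    refine ⟨?_, fun T hT hne hcl => ?_⟩
    · rcases hmeet with h | h
      · exact ⟨a, h, by simp⟩
      · exact ⟨b, h, by simp⟩
    by_cases hTab : a ∈ T ∨ b ∈ T
    -- `T` contains all of `{a, b} ∩ B i`, so adding the other side of `B i` keeps it closed.
    · have haT : a ∈ B i → a ∈ T := fun ha => hTab.elim id fun hb =>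
        hcl b hb a ⟨ha, by simp⟩ hab.symm
      have hbT : b ∈ B i → b ∈ T := fun hb => hTab.elim (fun ha =>
        hcl a ha b ⟨hb, by simp⟩ hab) id
      have := (hc i).2 (T ∪ (B i ∩ D'))
        (Set.union_subset (hT.trans Set.inter_subset_left) Set.inter_subset_left)
        (hne.mono Set.subset_union_left) (by
          rintro u (hu | ⟨huB, huD'⟩) v hv huv
          · rcases hB i hv with hv' | hv' | hv'
            · exact Or.inl (hcl u hu v ⟨hv, Or.inl hv'⟩ huv)
            · exact Or.inl (hcl u hu v ⟨hv, Or.inr hv'⟩ huv)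
            · exact Or.inr ⟨hv, hv'⟩
          · rcases hB i hv with (rfl | rfl) | hv' | hv'
            · exact Or.inl (haT hv)
            · exact Or.inl (hbT hv)
            · exact absurd huv.symm (hD v hv' u huD')
            · exact Or.inr ⟨hv, hv'⟩)
      rintro w ⟨hwB, hw⟩
      rcases this hwB with h | h
      · exact h
      · exact absurd h.2 (hdis hw)
    · have hTD : T ⊆ D := by
        intro t ht
        rcases (hT ht).2 with (rfl | rfl) | h
        · exact absurd (Or.inl ht) hTab
        · exact absurd (Or.inr ht) hTab
        · exact h
      have := (hc i).2 T (hT.trans Set.inter_subset_left) hne (by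
        intro u hu v hv huv
        rcases hB i hv with hv' | hv' | hv'
        · exact hcl u hu v ⟨hv, Or.inl hv'⟩ huv
        · exact hcl u hu v ⟨hv, Or.inr hv'⟩ huv
        · exact absurd huv (hD u (hTD hu) v hv'))
      exact Set.inter_subset_left.trans this
  · have key : ∀ i j, i ≠ j → a ∉ B i → b ∉ B i →
        ∃ x ∈ B i ∩ ({a, b} ∪ D), ∃ y ∈ B j ∩ ({a, b} ∪ D), Γ.Adj x y := by
      intro i j hij hai hbi
      obtain ⟨x, hx, y, hy, hxy⟩ := hadj i j hij
      have hxD := hside i hai hbi hx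
      refine ⟨x, ⟨hx, Or.inr hxD⟩, y, ⟨hy, ?_⟩, hxy⟩
      rcases hB j hy with h | h | h
      · exact Or.inl h
      · exact Or.inr h
      · exact absurd hxy (hD x hxD y h)
    by_cases hi : a ∉ B i ∧ b ∉ B i
    · exact key i j hij hi.1 hi.2
    by_cases hj : a ∉ B j ∧ b ∉ B j
    · obtain ⟨x, hx, y, hy, hxy⟩ := key j i hij.symm hj.1 hj.2
      exact ⟨y, hy, x, hx, hxy.symm⟩
    have hdij := Set.disjoint_left.1 (hd i j hij)
    by_cases hai : a ∈ B i
    · exact ⟨a, ⟨hai, by simp⟩, b, ⟨by_contra fun h => hj ⟨hdij hai, h⟩, by simp⟩, hab⟩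
    · have hbi : b ∈ B i := by_contra fun h => hi ⟨hai, h⟩
      exact ⟨b, ⟨hbi, by simp⟩, a, ⟨by_contra fun h => hj ⟨h, hdij hbi⟩, by simp⟩, hab.symm⟩

/-- `K₄` is 3-connected: a `K₄` model in the union of two sides glued along an edge `ab` yields a
`K₄` model within one of the sides. -/
lemma two_sum {D D' : Set α} {a b : α} (hab : Γ.Adj a b) (hD : ∀ u ∈ D, ∀ v ∈ D', ¬ Γ.Adj u v)
    (haD : a ∉ D) (hbD : b ∉ D) (haD' : a ∉ D') (hbD' : b ∉ D') (hdis : Disjoint D D')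
    (h : Γ.HasK4In ({a, b} ∪ (D ∪ D'))) : Γ.HasK4In ({a, b} ∪ D) ∨ Γ.HasK4In ({a, b} ∪ D') := by
  have hdis₁ : Disjoint ({a, b} ∪ D) D' := by
    rw [Set.disjoint_left] at hdis ⊢
    rintro w ((rfl | rfl) | hw) hw'
    exacts [haD' hw', hbD' hw', hdis hw hw']
  have hdis₂ : Disjoint ({a, b} ∪ D') D := by
    rw [Set.disjoint_left] at hdis ⊢
    rintro w ((rfl | rfl) | hw) hw'
    exacts [haD hw', hbD hw', hdis hw' hw]
  obtain ⟨B, hB, hc, hd, hadj⟩ := h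
  have hone : ∀ i, a ∉ B i → b ∉ B i → B i ⊆ D ∨ B i ⊆ D' := by
    intro i hai hbi
    have hBi : B i ⊆ D ∪ D' := by
      intro w hw
      rcases hB i hw with (rfl | rfl) | h
      exacts [absurd hw hai, absurd hw hbi, h]
    by_cases hmeet : (B i ∩ D).Nonempty
    · obtain ⟨p, hp, hpD⟩ := hmeet
      refine Or.inl ((hc i).subset_of_closed hBi (fun u hu v hv huv => ?_) hp hpD)
      exact hv.resolve_right fun hv' => hD u hu v hv' huv
    · exact Or.inr fun w hw => (hBi hw).resolve_left fun hwD => hmeet ⟨w, hw, hwD⟩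
  by_cases hall : ∀ i, a ∉ B i → b ∉ B i → B i ⊆ D
  · exact Or.inl (restrict_side hab hD hdis₁ hB hc hd hadj hall)
  · push Not at hall
    obtain ⟨i, hai, hbi, hi⟩ := hall
    have hi' := (hone i hai hbi).resolve_left hi
    refine Or.inr (restrict_side (D := D') (D' := D) hab
      (fun u hu v hv huv => hD v hv u hu huv.symm) hdis₂ (by rwa [Set.union_comm D' D]) hc hd hadj
      fun j haj hbj => ?_)
    refine (hone j haj hbj).resolve_left fun hj => ?_
    by_cases hij : i = j
    · exact hi (hij ▸ hj)
    · obtain ⟨x, hx, y, hy, hxy⟩ := hadj i j hij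
      exact hD y (hj hy) x (hi' hx) hxy.symm

/-- A `K₄` model survives the removal of a vertex `w` whose neighbours are among the ends of an
edge. -/
lemma remove_vertex {Y : Set α} {a b w : α} (hab : Γ.Adj a b) (ha : a ∈ Y) (hb : b ∈ Y)
    (hw : w ∉ Y) (hN : ∀ v ∈ Y, Γ.Adj w v → v = a ∨ v = b) (h : Γ.HasK4In (insert w Y)) :
    Γ.HasK4In Y := by
  have hwa : a ≠ w := fun h => hw (h ▸ ha)
  have hwb : b ≠ w := fun h => hw (h ▸ hb)
  have hdis : Disjoint {w} (Y \ {a, b}) := by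
    rw [Set.disjoint_singleton_left]
    exact fun h => hw h.1
  rcases two_sum (D := {w}) (D' := Y \ {a, b}) hab
    (by rintro u rfl v hv huv; exact hv.2 (hN v hv.1 huv)) hwa hwb (by simp) (by simp) hdis
    (h.mono_set (by grind)) with h | h
  · rw [Set.union_singleton] at h
    exact absurd h (not_triple _ _ _)
  · exact h.mono_set (by grind)

/-- A virtual edge `ab` in a `K₄` model may be replaced by a connected set `T` disjoint from the
model and adjacent to both `a` and `b`. -/
lemma replace_edge {Y T : Set α} {a b : α}
    (h : (Γ ⊔ edge a b).HasK4In Y) (hT : Γ.IsConnSet T) (hYT : Disjoint Y T)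
    (hTa : ∃ t ∈ T, Γ.Adj a t) (hTb : ∃ t ∈ T, Γ.Adj b t) : Γ.HasK4In (Y ∪ T) := by
  have hΓ : ∀ u v, (Γ ⊔ edge a b).Adj u v → Γ.Adj u v ∨ (u = a ∧ v = b) ∨ (u = b ∧ v = a) := by
    intro u v huv
    rw [sup_adj, edge_adj] at huv
    grind
  obtain ⟨B, hB, hc, hd, hadj⟩ := h
  obtain ⟨s, hs, has⟩ := hTa
  obtain ⟨t, ht, hbt⟩ := hTb
  -- The branch set containing `a`, if there is one, absorbs `T`.
  set B' : Fin 4 → Set α := fun i => {v | v ∈ B i ∨ (a ∈ B i ∧ v ∈ T)}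
  have hBB' : ∀ i, B i ⊆ B' i := fun i v hv => Or.inl hv
  rw [Set.disjoint_left] at hYT
  refine ⟨B', fun i v hv => ?_, fun i => ⟨(hc i).1.mono (hBB' i), fun R hR hne hcl => ?_⟩,
    fun i j hij => ?_, fun i j hij => ?_⟩
  · rcases hv with hv | ⟨-, hv⟩
    · exact Or.inl (hB i hv)
    · exact Or.inr hv
  · by_cases hai : a ∈ B i
    · by_cases hRT : (R ∩ T).Nonempty
      · have hTR : T ⊆ R := (hT.2 (R ∩ T) Set.inter_subset_right hRT fun u hu v hv huv =>
          ⟨hcl u hu.1 v (Or.inr ⟨hai, hv⟩) huv, hv⟩).trans Set.inter_subset_left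
        have haR : a ∈ R := hcl s (hTR hs) a (Or.inl hai) has.symm
        have hbR : b ∈ B i → b ∈ R := fun hb => hcl t (hTR ht) b (Or.inl hb) hbt.symm
        have hBR : B i ⊆ R := ((hc i).2 (R ∩ B i) Set.inter_subset_right ⟨a, haR, hai⟩
          fun u hu v hv huv => ⟨by
            rcases hΓ u v huv with h | ⟨-, rfl⟩ | ⟨-, rfl⟩
            · exact hcl u hu.1 v (Or.inl hv) h
            · exact hbR hv
            · exact haR, hv⟩).trans Set.inter_subset_left
        rintro v (hv | ⟨-, hv⟩)
        · exact hBR hv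
        · exact hTR hv
      · exfalso
        have hRB : R ⊆ B i := fun v hv => (hR hv).elim id fun h => absurd ⟨v, hv, h.2⟩ hRT
        have haR : a ∉ R := fun haR => hRT ⟨s, hcl a haR s (Or.inr ⟨hai, hs⟩) has, hs⟩
        have hbR : b ∉ R := fun hbR => hRT ⟨t, hcl b hbR t (Or.inr ⟨hai, ht⟩) hbt, ht⟩
        refine haR ((hc i).2 R hRB hne (fun u hu v hv huv => ?_) hai)
        rcases hΓ u v huv with h | ⟨rfl, -⟩ | ⟨rfl, -⟩
        exacts [hcl u hu v (Or.inl hv) h, absurd hu haR, absurd hu hbR]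
    · have hRB : R ⊆ B i := fun v hv => (hR hv).elim id fun h => absurd h.1 hai
      have hBR : B i ⊆ R := (hc i).2 R hRB hne fun u hu v hv huv => by
        rcases hΓ u v huv with h | ⟨rfl, -⟩ | ⟨-, rfl⟩
        exacts [hcl u hu v (Or.inl hv) h, absurd (hRB hu) hai, absurd hv hai]
      rintro v (hv | hv)
      · exact hBR hv
      · exact absurd hv.1 hai
  · have := Set.disjoint_left.1 (hd i j hij)
    rw [Set.disjoint_left]
    rintro v (hv | ⟨hai, hv⟩) (hv' | ⟨haj, hv'⟩)
    exacts [this hv hv', hYT (hB i hv) hv', hYT (hB j hv') hv, this hai haj]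
  · obtain ⟨x, hx, y, hy, hxy⟩ := hadj i j hij
    rcases hΓ x y hxy with h | ⟨rfl, rfl⟩ | ⟨rfl, rfl⟩
    · exact ⟨x, hBB' i hx, y, hBB' j hy, h⟩
    · exact ⟨t, Or.inr ⟨hx, ht⟩, _, hBB' j hy, hbt.symm⟩
    · exact ⟨_, hBB' i hx, t, Or.inr ⟨hy, ht⟩, hbt⟩

end HasK4In

/-! ### Ears over a vertex set -/

/-- `x` is an ear over `S` with ends `a` and `b`: a vertex outside `S` whose neighbours in `S` are
exactly the distinct vertices `a` and `b`, which no single vertex separates within `S`. Taking `c`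
outside `S` (for instance `c = x`) in `conn` shows that `a` and `b` are connected within `S`. -/
structure IsEar (Γ : SimpleGraph α) (S : Set α) (x a b : α) : Prop where
  notMem : x ∉ S
  left_mem : a ∈ S
  right_mem : b ∈ S
  ne : a ≠ b
  adj_iff : ∀ v ∈ S, Γ.Adj x v ↔ v = a ∨ v = b
  conn : ∀ c, c ≠ a → c ≠ b → ∃ Z ⊆ S, Γ.IsConnSet Z ∧ a ∈ Z ∧ b ∈ Z ∧ c ∉ Z

namespace IsEar

variable {S D : Set α} {x y z a b c d : α}

lemma symm (h : Γ.IsEar S x a b) : Γ.IsEar S x b a where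
  notMem := h.notMem
  left_mem := h.right_mem
  right_mem := h.left_mem
  ne := h.ne.symm
  adj_iff v hv := by rw [h.adj_iff v hv, or_comm]
  conn c hcb hca := by
    obtain ⟨Z, h1, h2, h3, h4, h5⟩ := h.conn c hca hcb
    exact ⟨Z, h1, h2, h4, h3, h5⟩

lemma left_adj (h : Γ.IsEar S x a b) : Γ.Adj x a := (h.adj_iff a h.left_mem).2 (Or.inl rfl)

lemma right_adj (h : Γ.IsEar S x a b) : Γ.Adj x b := (h.adj_iff b h.right_mem).2 (Or.inr rfl)

lemma insert (h : Γ.IsEar S y a b) (hne : y ≠ x) (hadj : ¬ Γ.Adj y x) :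
    Γ.IsEar (insert x S) y a b where
  notMem := by
    rintro (h' | h')
    exacts [hne h', h.notMem h']
  left_mem := Or.inr h.left_mem
  right_mem := Or.inr h.right_mem
  ne := h.ne
  adj_iff v hv := by
    rcases hv with rfl | hv
    · refine ⟨fun h' => absurd h' hadj, ?_⟩
      rintro (rfl | rfl)
      exacts [h.left_adj, h.right_adj]
    · exact h.adj_iff v hv
  conn c hca hcb := by
    obtain ⟨Z, h1, h2⟩ := h.conn c hca hcb
    exact ⟨Z, h1.trans (Set.subset_insert _ _), h2⟩

/-- A component `D` of `S \ {e, e'}` separating the ends of an ear has a neighbour `e`. -/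
lemma exists_adj_of_separates {e e' : α} (h : Γ.IsEar S y c d) (hcD : c ∈ D) (hdD : d ∉ D)
    (hD : ∀ u ∈ D, ∀ v ∈ S, v ≠ e → v ≠ e' → Γ.Adj u v → v ∈ D) (hc : e' ≠ c) (hd : e' ≠ d) :
    ∃ u ∈ D, Γ.Adj e u := by
  obtain ⟨Z, hZS, hZ, hcZ, hdZ, heZ⟩ := h.conn e' hc hd
  obtain ⟨u, hu, v, hv, hvD, huv⟩ := hZ.exists_adj (T := D ∩ Z) Set.inter_subset_right
    ⟨c, hcD, hcZ⟩ hdZ fun h => hdD h.1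
  refine ⟨u, hu.1, ?_⟩
  by_cases hve : v = e
  · exact hve ▸ huv.symm
  · exact absurd ⟨hD u hu.1 v (hZS hv) hve (fun h => heZ (h ▸ hv)) huv, hv⟩ hvD

/-- Two ears do not cross: if adding both ears creates no `K₄` minor, then the ends of one do not
lie in different components of `S` minus the ends of the other. -/
lemma mem_side (hx : Γ.IsEar S x a b) (hy : Γ.IsEar S y c d) (hxy : x ≠ y)
    (hK : ¬ Γ.HasK4In (Insert.insert x (Insert.insert y S))) (hDS : D ⊆ S \ {a, b})
    (hDc : Γ.IsConnSet D) (hD : ∀ u ∈ D, ∀ v ∈ S, v ≠ a → v ≠ b → Γ.Adj u v → v ∈ D)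
    (hcD : c ∈ D) : d ∈ ({a, b} ∪ D : Set α) := by
  by_contra hd
  have hda : d ≠ a := fun h => hd (Or.inl (Or.inl h))
  have hdb : d ≠ b := fun h => hd (Or.inl (Or.inr h))
  have hdD : d ∉ D := fun h => hd (Or.inr h)
  have hca : c ≠ a := fun h => (hDS hcD).2 (Or.inl h)
  have hcb : c ≠ b := fun h => (hDS hcD).2 (Or.inr h)
  obtain ⟨E, hES, hdE, hEc, hE'⟩ := IsConnSet.exists_component (Γ := Γ) (Z := S \ {a, b}) (p := d)
    ⟨hy.right_mem, by grind⟩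
  have hE : ∀ u ∈ E, ∀ v ∈ S, v ≠ a → v ≠ b → Γ.Adj u v → v ∈ E := fun u hu v hv hva hvb huv =>
    hE' u hu v ⟨hv, by grind⟩ huv
  have hDE : Disjoint D E := by
    rw [Set.disjoint_left]
    intro p hpD hpE
    exact hdD (hEc.subset_of_closed hES (fun u hu v hv huv =>
      hD u hu v hv.1 (fun h => hv.2 (Or.inl h)) (fun h => hv.2 (Or.inr h)) huv) hpE hpD hdE)
  have hcE : c ∉ E := Set.disjoint_left.1 hDE hcD
  have swap : ∀ {E : Set α}, (∀ u ∈ E, ∀ v ∈ S, v ≠ a → v ≠ b → Γ.Adj u v → v ∈ E) →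
      ∀ u ∈ E, ∀ v ∈ S, v ≠ b → v ≠ a → Γ.Adj u v → v ∈ E :=
    fun h u hu v hv hb ha => h u hu v hv ha hb
  obtain ⟨u₁, hu₁, h₁⟩ := hy.exists_adj_of_separates hcD hdD hD hcb.symm hdb.symm
  obtain ⟨u₂, hu₂, h₂⟩ := hy.exists_adj_of_separates hcD hdD (swap hD) hca.symm hda.symm
  obtain ⟨u₃, hu₃, h₃⟩ := hy.symm.exists_adj_of_separates hdE hcE hE hdb.symm hcb.symm
  obtain ⟨u₄, hu₄, h₄⟩ := hy.symm.exists_adj_of_separates hdE hcE (swap hE) hda.symm hca.symm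
  have hab := hx.ne
  have haS := hx.left_mem
  have hbS := hx.right_mem
  have hxS := hx.notMem
  have hyS := hy.notMem
  refine hK (HasK4In.of_sets (P := {a, x}) (Q := {b}) (R := Insert.insert y D) (T := E)
    ?_ ?_ ?_ ?_ (.pair hx.left_adj.symm) (.singleton b) (hDc.insert hcD hy.left_adj.symm) hEc
    ?_ ?_ ?_ ?_ ?_ ?_ ⟨x, by simp, b, rfl, hx.right_adj⟩ ⟨a, by simp, u₁, Or.inr hu₁, h₁⟩
    ⟨a, by simp, u₃, hu₃, h₃⟩ ⟨b, rfl, u₂, Or.inr hu₂, h₂⟩ ⟨b, rfl, u₄, hu₄, h₄⟩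
    ⟨y, Or.inl rfl, d, hdE, hy.right_adj⟩)
  all_goals
    clear hD hE hE' swap hK hDc hEc
    try rw [Set.disjoint_left] at *
    grind

/-- If an ear with ends `a`, `b` creates no `K₄` minor, then no component `D` of `S \ {a, b}`
carries the whole connection between `a` and `b`: otherwise, by Menger's theorem, `D` would contain
two disjoint connections, which form a `K₄` model with `a` and `b`. -/
lemma exists_other_side (hx : Γ.IsEar S x a b) (hS : S.Finite)
    (hK : ¬ Γ.HasK4In (Insert.insert x S)) (hDS : D ⊆ S \ {a, b}) (hDc : Γ.IsConnSet D)
    (hD : ∀ u ∈ D, ∀ v ∈ S, v ≠ a → v ≠ b → Γ.Adj u v → v ∈ D) :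
    Γ.Adj a b ∨ ∃ T ⊆ S \ {a, b}, Disjoint T D ∧ Γ.IsConnSet T ∧ (∃ t ∈ T, Γ.Adj a t) ∧
      ∃ t ∈ T, Γ.Adj b t := by
  by_contra! H
  obtain ⟨hab, H⟩ := H
  have key : ∀ c, c ≠ a → c ≠ b → ∃ T ⊆ D, c ∉ T ∧ Γ.IsConnSet T ∧
      (T ∩ {v | Γ.Adj a v}).Nonempty ∧ (T ∩ {v | Γ.Adj b v}).Nonempty := by
    intro c hca hcb
    obtain ⟨Z, hZS, hZ, haZ, hbZ, hcZ⟩ := hx.conn c hca hcb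
    obtain ⟨T, hTZ, hT, ⟨s, hs, has⟩, ⟨t, ht, hbt⟩⟩ := hZ.exists_interior haZ hbZ hx.ne hab
    have hTS : T ⊆ S \ {a, b} := fun v hv => ⟨hZS (hTZ hv).1, (hTZ hv).2⟩
    have hTD : ¬ Disjoint T D := fun hdis => H T hTS hdis hT ⟨s, hs, has⟩ t ht hbt
    obtain ⟨p, hpT, hpD⟩ := Set.not_disjoint_iff.1 hTD
    exact ⟨T, hT.subset_of_closed hTS (fun u hu v hv huv => hD u hu v hv.1
      (fun h => hv.2 (Or.inl h)) (fun h => hv.2 (Or.inr h)) huv) hpT hpD,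
      fun h => hcZ (hTZ h).1, hT, ⟨s, hs, has⟩, ⟨t, ht, hbt⟩⟩
  have hxS := hx.notMem
  have hxa : x ≠ a := fun h => hxS (h ▸ hx.left_mem)
  have hxb : x ≠ b := fun h => hxS (h ▸ hx.right_mem)
  have : Nonempty α := ⟨x⟩
  obtain ⟨X, hXD, Y, hYD, hXY, hXc, hYc, ⟨u₁, hu₁, h₁⟩, ⟨u₂, hu₂, h₂⟩, ⟨u₃, hu₃, h₃⟩,
      ⟨u₄, hu₄, h₄⟩⟩ := exists_disjoint_connections (Γ := Γ)
    (hS.subset (hDS.trans Set.sdiff_subset)) {v | Γ.Adj a v} {v | Γ.Adj b v} fun c => by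
      by_cases hc : c = a ∨ c = b
      · obtain ⟨T, hT, -, hrest⟩ := key x hxa hxb
        exact ⟨T, hT, fun h => (hDS (hT h)).2 hc, hrest⟩
      · exact key c (fun h => hc (Or.inl h)) (fun h => hc (Or.inr h))
  -- Enlarge `Y` to a component of `D \ X`, which is then adjacent to `X`.
  have hYDX : Y ⊆ D \ X := fun v hv => ⟨hYD hv, fun h => Set.disjoint_left.1 hXY h hv⟩
  obtain ⟨E, hED, hE₂, hEc, hE⟩ := IsConnSet.exists_component (Γ := Γ) (hYDX hu₂)
  have hYE : Y ⊆ E := hYc.subset_of_closed hYDX hE hu₂ hE₂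
  obtain ⟨s, hs, t, ht, htE, hst⟩ := hDc.exists_adj (T := E) (fun v hv => (hED hv).1)
    ⟨u₂, hE₂⟩ (hXD hu₁) fun h => (hED h).2 hu₁
  have htX : t ∈ X := by
    by_contra htX
    exact htE (hE s hs t ⟨ht, htX⟩ hst)
  have hab' := hx.ne
  have haS := hx.left_mem
  have hbS := hx.right_mem
  refine hK (HasK4In.of_sets (P := {a, x}) (Q := {b}) (R := X) (T := E)
    ?_ ?_ ?_ ?_ (.pair hx.left_adj.symm) (.singleton b) hXc hEc
    ?_ ?_ ?_ ?_ ?_ ?_ ⟨x, by simp, b, rfl, hx.right_adj⟩ ⟨a, by simp, u₁, hu₁, h₁⟩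
    ⟨a, by simp, u₂, hE₂, h₂⟩ ⟨b, rfl, u₃, hu₃, h₃⟩ ⟨b, rfl, u₄, hYE hu₄, h₄⟩
    ⟨t, htX, s, hs, hst.symm⟩)
  all_goals
    clear hD hE key hK H hDc hEc hXc hYc hXY
    try rw [Set.disjoint_left]
    grind

/-- Three ears, any two of which create no `K₄` minor, create none together. -/
theorem not_hasK4In_triple {p q : α} (hS : S.Finite) (hx : Γ.IsEar S x a b)
    (hy : Γ.IsEar S y c d) (hz : Γ.IsEar S z p q) (hxy : x ≠ y) (hxz : x ≠ z) (hyz : y ≠ z)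
    (nxy : ¬ Γ.Adj x y) (nxz : ¬ Γ.Adj x z) (nyz : ¬ Γ.Adj y z)
    (kxy : ¬ Γ.HasK4In (Insert.insert x (Insert.insert y S)))
    (kxz : ¬ Γ.HasK4In (Insert.insert x (Insert.insert z S)))
    (kyz : ¬ Γ.HasK4In (Insert.insert y (Insert.insert z S))) :
    ¬ Γ.HasK4In (Insert.insert x (Insert.insert y (Insert.insert z S))) := by
  intro h
  have hxS := hx.notMem
  have hyS := hy.notMem
  have hzS := hz.notMem
  have haS := hx.left_mem
  have hbS := hx.right_mem
  have hΓ'ab : (Γ ⊔ edge a b).Adj a b := by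
    rw [sup_adj, edge_adj]
    exact Or.inr ⟨Or.inl ⟨rfl, rfl⟩, hx.ne⟩
  have hΓ' : ∀ u v, (Γ ⊔ edge a b).Adj u v →
      Γ.Adj u v ∨ ((u = a ∨ u = b) ∧ (v = a ∨ v = b)) := by
    intro u v huv
    rw [sup_adj, edge_adj] at huv
    grind
  have hya : y ≠ a := fun h => hyS (h ▸ haS)
  have hyb : y ≠ b := fun h => hyS (h ▸ hbS)
  have hza : z ≠ a := fun h => hzS (h ▸ haS)
  have hzb : z ≠ b := fun h => hzS (h ▸ hbS)
  -- The ear `x` is exchanged for the virtual edge `ab`, and back.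
  have hyzS : (Γ ⊔ edge a b).HasK4In (Insert.insert y (Insert.insert z S)) := by
    refine (h.mono_graph le_sup_left).remove_vertex hΓ'ab (by simp [haS]) (by simp [hbS])
      (by grind) fun v hv hxv => ?_
    rcases hΓ' x v hxv with h' | h'
    · rcases hv with rfl | rfl | hv
      exacts [absurd h' nxy, absurd h' nxz, (hx.adj_iff v hv).1 h']
    · exact h'.2
  have restore : ∀ {Y : Set α}, x ∉ Y → (Γ ⊔ edge a b).HasK4In Y →
      Γ.HasK4In (Y ∪ {x}) := fun hxY hK =>
    hK.replace_edge (.singleton x) (Set.disjoint_singleton_right.2 hxY)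
      ⟨x, rfl, hx.left_adj.symm⟩ ⟨x, rfl, hx.right_adj.symm⟩
  have main : ∀ c d, Γ.IsEar S y c d → c ≠ a → c ≠ b → False := by
    intro c d hy hca hcb
    obtain ⟨D, hDS, hcD, hDc, hD'⟩ := IsConnSet.exists_component (Γ := Γ) (Z := S \ {a, b})
      (p := c) ⟨hy.left_mem, by grind⟩
    have hD : ∀ u ∈ D, ∀ v ∈ S, v ≠ a → v ≠ b → Γ.Adj u v → v ∈ D :=
      fun u hu v hv hva hvb huv => hD' u hu v ⟨hv, by grind⟩ huv
    have hd : d ∈ ({a, b} ∪ D : Set α) := hx.mem_side hy hxy kxy hDS hDc hD hcD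
    have hyN : ∀ v ∈ (S \ {a, b}) \ D, ¬ Γ.Adj y v := by
      rintro v ⟨⟨hvS, hvab⟩, hvD⟩ hyv
      rcases (hy.adj_iff v hvS).1 hyv with rfl | rfl
      · exact hvD hcD
      · exact hd.elim hvab hvD
    have hDS' : D ⊆ S := hDS.trans Set.sdiff_subset
    have haD : a ∉ D := fun h => (hDS h).2 (Or.inl rfl)
    have hbD : b ∉ D := fun h => (hDS h).2 (Or.inr rfl)
    have habS : {a, b} ⊆ S := Set.pair_subset haS hbS
    have hDE : Disjoint D ((S \ {a, b}) \ D) := Set.disjoint_sdiff_right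
    have hES : (S \ {a, b}) \ D ⊆ S := Set.sdiff_subset.trans Set.sdiff_subset
    have hSE : S ⊆ {a, b} ∪ (D ∪ (S \ {a, b}) \ D) := fun w hw => by
      by_cases hwab : w ∈ ({a, b} : Set α)
      · exact Or.inl hwab
      by_cases hwD : w ∈ D
      exacts [Or.inr (Or.inl hwD), Or.inr (Or.inr ⟨⟨hw, hwab⟩, hwD⟩)]
    have haE : a ∉ (S \ {a, b}) \ D := fun h => h.1.2 (Or.inl rfl)
    have hbE : b ∉ (S \ {a, b}) \ D := fun h => h.1.2 (Or.inr rfl)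
    have hyD : y ∉ D := fun h => hyS (hDS' h)
    have hzD : z ∉ D := fun h => hzS (hDS' h)
    by_cases hpq : p ∈ D ∨ q ∈ D
    · have hpq' : p ∈ ({a, b} ∪ D : Set α) ∧ q ∈ ({a, b} ∪ D : Set α) := by
        rcases hpq with hp | hq
        · exact ⟨Or.inr hp, hx.mem_side hz hxz kxz hDS hDc hD hp⟩
        · exact ⟨hx.mem_side hz.symm hxz kxz hDS hDc hD hq, Or.inr hq⟩
      have hno : ∀ u ∈ D ∪ {y, z}, ∀ v ∈ (S \ {a, b}) \ D, ¬ (Γ ⊔ edge a b).Adj u v := by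
        rintro u hu v hv huv
        have hva : v ≠ a := fun h => hv.1.2 (Or.inl h)
        have hvb : v ≠ b := fun h => hv.1.2 (Or.inr h)
        rcases hΓ' u v huv with huv | huv
        · rcases hu with hu | rfl | rfl
          · exact hv.2 (hD u hu v hv.1.1 hva hvb huv)
          · exact hyN v hv huv
          · rcases (hz.adj_iff v hv.1.1).1 huv with rfl | rfl
            · exact hpq'.1.elim hv.1.2 hv.2
            · exact hpq'.2.elim hv.1.2 hv.2
        · exact huv.2.elim hva hvb
      generalize (S \ {a, b}) \ D = E at *
      rcases HasK4In.two_sum hΓ'ab hno (by grind) (by grind) haE hbE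
        (by clear * - hDE hES hyS hzS; rw [Set.disjoint_left] at *; grind)
        (hyzS.mono_set (by clear * - hSE; grind)) with hK | hK
      · rcases hx.exists_other_side hS
            (fun h => kxy (h.mono_set (Set.insert_subset_insert (Set.subset_insert _ _))))
            hDS hDc hD with hab | ⟨T, hTS, hTD, hTc, hTa, hTb⟩
        · rw [sup_edge_of_adj _ hab] at hK
          exact kyz (hK.mono_set (by clear * - habS hDS'; grind))
        · rw [Set.disjoint_left] at hTD
          have hdisT : Disjoint ({a, b} ∪ (D ∪ {y, z})) T := by
            rw [Set.disjoint_left]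
            rintro w (hw | hw | rfl | rfl) hwT
            exacts [(hTS hwT).2 hw, hTD hwT hw, hyS (hTS hwT).1, hzS (hTS hwT).1]
          refine kyz ((hK.replace_edge hTc hdisT hTa hTb).mono_set ?_)
          rintro w (((rfl | rfl) | hw | rfl | rfl) | hw)
          exacts [Or.inr (Or.inr haS), Or.inr (Or.inr hbS), Or.inr (Or.inr (hDS hw).1), Or.inl rfl,
            Or.inr (Or.inl rfl), Or.inr (Or.inr (hTS hw).1)]
      · refine kxy ((restore ?_ hK).mono_set ?_)
        · clear * - habS hES hxS
          grind
        · clear * - habS hES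
          grind
    · have hno : ∀ u ∈ D ∪ {y}, ∀ v ∈ (S \ {a, b}) \ D ∪ {z}, ¬ (Γ ⊔ edge a b).Adj u v := by
        rintro u hu v hv huv
        have hva : v ≠ a := by grind
        have hvb : v ≠ b := by grind
        rcases hΓ' u v huv with huv | huv
        · rcases hu with hu | rfl
          · rcases hv with hv | rfl
            · exact hv.2 (hD u hu v hv.1.1 hva hvb huv)
            · rcases (hz.adj_iff u (hDS hu).1).1 huv.symm with rfl | rfl
              · exact hpq (Or.inl hu)
              · exact hpq (Or.inr hu)
          · rcases hv with hv | rfl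
            · exact hyN v hv huv
            · exact nyz huv
        · exact huv.2.elim hva hvb
      generalize (S \ {a, b}) \ D = E at *
      rcases HasK4In.two_sum hΓ'ab hno (by grind) (by grind) (by grind) (by grind)
        (by clear * - hDE hES hyS hzD hyz; rw [Set.disjoint_left] at *; grind)
        (hyzS.mono_set (by
          rintro w (rfl | rfl | hw)
          · exact Or.inr (Or.inl (Or.inr rfl))
          · exact Or.inr (Or.inr (Or.inr rfl))
          · have := hSE hw
            clear * - this
            grind)) with hK | hK
      · refine kxy ((restore ?_ hK).mono_set ?_)
        · clear * - habS hDS' hxS hxy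
          grind
        · clear * - habS hDS'
          grind
      · refine kxz ((restore ?_ hK).mono_set ?_)
        · clear * - habS hES hxS hxz
          grind
        · clear * - habS hES
          grind
  by_cases hc : c = a ∨ c = b
  · by_cases hd : d = a ∨ d = b
    -- The ears `x` and `y` are parallel.
    · have hzS' : (Γ ⊔ edge a b).HasK4In (Insert.insert z S) := by
        refine hyzS.remove_vertex hΓ'ab (by simp [haS]) (by simp [hbS]) (by grind)
          fun v hv hyv => ?_
        rcases hΓ' y v hyv with h' | h'
        · rcases hv with rfl | hv
          · exact absurd h' nyz
          · rcases (hy.adj_iff v hv).1 h' with rfl | rfl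
            exacts [hc, hd]
        · exact h'.2
      exact kxz ((restore (by grind) hzS').mono_set (by grind))
    · exact main d c hy.symm (fun h => hd (Or.inl h)) (fun h => hd (Or.inr h))
  · exact main c d hy (fun h => hc (Or.inl h)) (fun h => hc (Or.inr h))

/-- Pairwise compatible ears are jointly compatible. By induction on the number of ears: one of
them is moved into `S`, and `not_hasK4In_triple` keeps the others pairwise compatible. -/
theorem not_hasK4In_union (E : Finset α) (hS : S.Finite) (hE : ∀ x ∈ E, ∃ a b, Γ.IsEar S x a b)
    (hindep : ∀ x ∈ E, ∀ y ∈ E, ¬ Γ.Adj x y) (hK : ¬ Γ.HasK4In S)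
    (hpair : ∀ x ∈ E, ∀ y ∈ E, ¬ Γ.HasK4In (Insert.insert x (Insert.insert y S))) :
    ¬ Γ.HasK4In (S ∪ E) := by
  classical
  induction E using Finset.induction_on generalizing S with
  | empty => simpa
  | insert x E hxE ih =>
    have hx := Finset.mem_insert_self x E
    have hE' : ∀ y ∈ E, y ∈ Insert.insert x E := fun y hy => Finset.mem_insert_of_mem hy
    have hne : ∀ y ∈ E, y ≠ x := fun y hy h => hxE (h ▸ hy)
    have hset : S ∪ ↑(Insert.insert x E) = Insert.insert x S ∪ (E : Set α) := by
      rw [Finset.coe_insert]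
      grind
    rw [hset]
    have hpx : ∀ y ∈ E, ¬ Γ.HasK4In (Insert.insert y (Insert.insert x S)) := fun y hy =>
      hpair y (hE' y hy) x hx
    refine ih (hS.insert x) (fun y hy => ?_) (fun y hy z hz => hindep y (hE' y hy) z (hE' z hz))
      (by simpa using hpair x hx x hx) fun y hy z hz => ?_
    · obtain ⟨a, b, hab⟩ := hE y (hE' y hy)
      exact ⟨a, b, hab.insert (hne y hy) (hindep y (hE' y hy) x hx)⟩
    · by_cases hyz : y = z
      · subst hyz
        rw [Set.insert_idem]
        exact hpx y hy
      · obtain ⟨a, b, h₁⟩ := hE y (hE' y hy)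
        obtain ⟨c, d, h₂⟩ := hE z (hE' z hz)
        obtain ⟨p, q, h₃⟩ := hE x hx
        exact not_hasK4In_triple hS h₁ h₂ h₃ hyz (hne y hy) (hne z hz)
          (hindep y (hE' y hy) z (hE' z hz)) (hindep y (hE' y hy) x hx)
          (hindep z (hE' z hz) x hx) (hpair y (hE' y hy) z (hE' z hz)) (hpx y hy) (hpx z hz)

end IsEar

end SimpleGraph

namespace Graph

variable {α β : Type*}

/-! ### Multigraphs and their adjacency graphs -/

/-- The simple graph of adjacency of distinct vertices of the multigraph `G`, on the whole vertex
type; elements outside the vertex set of `G` are isolated. -/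
def adjGraph (G : Graph α β) : SimpleGraph α where
  Adj u v := u ≠ v ∧ G.Adj u v
  symm := ⟨fun _ _ h => ⟨h.1.symm, h.2.symm⟩⟩
  loopless := ⟨fun _ h => h.1 rfl⟩

lemma connected_iff_isConnSet (G : Graph α β) :
    G.toSimpleGraph.Connected ↔ G.adjGraph.IsConnSet G.vertexSet := by
  constructor
  · intro h
    obtain ⟨p⟩ := h.nonempty
    refine ⟨⟨p, p.2⟩, fun T hT ⟨t, ht⟩ hcl v hv => ?_⟩
    obtain ⟨w⟩ := h.preconnected ⟨t, hT ht⟩ ⟨v, hv⟩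
    have key : ∀ {x y : G.vertexSet}, G.toSimpleGraph.Walk x y → (x : α) ∈ T → (y : α) ∈ T := by
      intro x y w
      induction w with
      | nil => exact id
      | cons hxy _ ih =>
        exact fun hx => ih (hcl _ hx _ (Subtype.prop _) ⟨fun h => hxy.1 (Subtype.ext h), hxy.2⟩)
    exact key w ht
  · intro h
    have : Nonempty G.vertexSet := h.1.to_subtype
    refine SimpleGraph.Connected.mk fun x y => ?_
    have := h.2 {v | ∃ hv : v ∈ G.vertexSet, G.toSimpleGraph.Reachable x ⟨v, hv⟩}
      (fun v hv => hv.1) ⟨x, x.2, .rfl⟩ (by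
        rintro u ⟨hu, hxu⟩ v hv huv
        exact ⟨hv, hxu.trans (SimpleGraph.Adj.reachable
          ⟨fun h => huv.1 (congrArg Subtype.val h), huv.2⟩)⟩)
    exact (this y.2).2

lemma adjGraph_induce_adj (G : Graph α β) (X : Set α) {u v : α} :
    (G.induce X).adjGraph.Adj u v ↔ G.adjGraph.Adj u v ∧ u ∈ X ∧ v ∈ X := by
  constructor
  · rintro ⟨hne, e, he, hu, hv⟩
    exact ⟨⟨hne, e, he⟩, hu, hv⟩
  · rintro ⟨⟨hne, e, he⟩, hu, hv⟩
    exact ⟨hne, e, he, hu, hv⟩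

lemma isConnSet_induce_iff (G : Graph α β) {X Z : Set α} (hZ : Z ⊆ X) :
    (G.induce X).adjGraph.IsConnSet Z ↔ G.adjGraph.IsConnSet Z := by
  refine and_congr_right fun _ => forall_congr' fun T => forall_congr' fun hT =>
    forall_congr' fun _ => ?_
  have : (∀ u ∈ T, ∀ v ∈ Z, (G.induce X).adjGraph.Adj u v → v ∈ T) ↔
      ∀ u ∈ T, ∀ v ∈ Z, G.adjGraph.Adj u v → v ∈ T :=
    forall₂_congr fun u hu => forall₂_congr fun v hv => by
      rw [adjGraph_induce_adj, and_iff_left ⟨hZ (hT hu), hZ hv⟩]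
  rw [this]

lemma hasK4Minor_induce_iff (G : Graph α β) (X : Set α) :
    (G.induce X).HasK4Minor ↔ G.adjGraph.HasK4In X := by
  refine exists_congr fun B => and_congr_right fun hB => ?_
  refine and_congr (forall_congr' fun i => ?_) (and_congr_right fun hd =>
    forall₂_congr fun i j => ?_)
  · rw [connected_iff_isConnSet]
    exact (isConnSet_induce_iff _ subset_rfl).trans (isConnSet_induce_iff _ (hB i))
  · rw [SimpleGraph.top_adj]
    refine forall_congr' fun hij => exists_congr fun x => and_congr_right fun hx =>
      exists_congr fun y => and_congr_right fun hy => ?_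
    have hne : x ≠ y := fun h => Set.disjoint_left.1 (hd i j hij) hx (h ▸ hy)
    exact ⟨fun h => ((adjGraph_induce_adj G X).1 ⟨hne, h⟩).1,
      fun h => ((adjGraph_induce_adj G X).2 ⟨h, hB i hx, hB j hy⟩).2⟩

/-- Deleting a vertex from a biconnected graph with another vertex leaves it connected. -/
lemma IsBiconnected.isConnSet_diff {B : Graph α β} (hB : B.IsBiconnected) {a c : α}
    (ha : a ∈ B.vertexSet) (hca : c ≠ a) : B.adjGraph.IsConnSet (B.vertexSet \ {c}) := by
  by_cases hc : c ∈ B.vertexSet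
  · have hcut := hB.2 c
    rw [IsCutVertex, not_and, not_lt] at hcut
    have : Subsingleton B.toSimpleGraph.ConnectedComponent :=
      hB.1.preconnected.subsingleton_connectedComponent
    have hsub : Subsingleton (B.deleteVerts {c}).toSimpleGraph.ConnectedComponent :=
      (ENat.card_le_one_iff_subsingleton _).1
        ((hcut hc).trans ((ENat.card_le_one_iff_subsingleton _).2 this))
    have hconn : (B.deleteVerts {c}).toSimpleGraph.Connected :=
      { preconnected := fun x y => SimpleGraph.ConnectedComponent.exact (Subsingleton.elim _ _)
        nonempty := ⟨⟨a, ha, fun h => hca h.symm⟩⟩ }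
    rw [connected_iff_isConnSet] at hconn
    exact (isConnSet_induce_iff B subset_rfl).1 hconn
  · rw [Set.sdiff_singleton_eq_self hc]
    exact (connected_iff_isConnSet B).1 hB.1

/-- In an independent instance every vertex outside `S` is an ear over `S`. -/
lemma IsIndependentInstance.exists_isEar {G : Graph α β} {S : Set α}
    (hGS : G.IsIndependentInstance S) {x : α} (hx : x ∈ G.vertexSet \ S) :
    ∃ a b, G.adjGraph.IsEar S x a b := by
  obtain ⟨a, b, hab, hN⟩ := Set.ncard_eq_two.1 (hGS.two_neighbors x hx)
  obtain ⟨B, hB, hsub⟩ := hGS.same_block x hx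
  obtain ⟨hBS, hbi⟩ := hB.prop
  rw [hN] at hsub
  have hmem : ∀ v, v ∈ S ∧ G.Adj x v ↔ v = a ∨ v = b := fun v => Set.ext_iff.1 hN v
  have hVS : B.vertexSet ⊆ S := hBS.vertexSet_mono
  have hle : B.adjGraph ≤ G.adjGraph := fun u v h =>
    ((adjGraph_induce_adj G S).1 ⟨h.1, h.2.mono hBS⟩).1
  have haB : a ∈ B.vertexSet := hsub (Or.inl rfl)
  have hbB : b ∈ B.vertexSet := hsub (Or.inr rfl)
  exact ⟨a, b,
    { notMem := hx.2
      left_mem := hVS haB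
      right_mem := hVS hbB
      ne := hab
      adj_iff := fun v hv => by
        rw [← hmem v]
        exact ⟨fun h => ⟨hv, h.2⟩, fun h => ⟨fun hxv => hx.2 (hxv ▸ hv), h.2⟩⟩
      conn := fun c hca hcb => ⟨B.vertexSet \ {c}, Set.sdiff_subset.trans hVS,
        (hbi.isConnSet_diff haB hca).mono hle, ⟨haB, fun h => hca h.symm⟩,
        ⟨hbB, fun h => hcb h.symm⟩, fun h => h.2 rfl⟩ }⟩

end Graph

theorem mainTheorem5 {α β : Type*} (G : Graph α β) [G.Loopless] (hfin : G.vertexSet.Finite)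
    (S : Set α) (hGS : G.IsIndependentInstance S)
    (W : Set α) (hW : W ⊆ G.vertexSet \ S) :
    G.IsDisjointK4MinorCover S W ↔
      (G.auxGraph S).IsVertexCover {v : ↥(G.vertexSet \ S) | (v : α) ∈ W} := by
  have hSV : S ⊆ G.vertexSet := hGS.cover.1
  have hdel : (G.deleteVerts W).HasK4Minor ↔ G.adjGraph.HasK4In (G.vertexSet \ W) :=
    G.hasK4Minor_induce_iff _
  constructor
  · rintro ⟨⟨-, hK⟩, -⟩ u v ⟨-, huv⟩
    by_contra! hno
    refine hK (hdel.2 (((G.hasK4Minor_induce_iff _).1 huv).mono_set ?_))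
    rintro w (hw | rfl | rfl)
    · exact ⟨hSV hw, fun h => (hW h).2 hw⟩
    · exact ⟨u.2.1, hno.1⟩
    · exact ⟨v.2.1, hno.2⟩
  · intro hcov
    refine ⟨⟨hW.trans Set.sdiff_subset, fun hK => ?_⟩, Set.disjoint_left.2 fun w hw => (hW hw).2⟩
    have hEfin : ((G.vertexSet \ S) \ W).Finite := hfin.subset fun w hw => hw.1.1
    have hmem : ∀ {w}, w ∈ hEfin.toFinset → w ∈ (G.vertexSet \ S) \ W := fun hw =>
      hEfin.mem_toFinset.1 hw
    refine SimpleGraph.IsEar.not_hasK4In_union hEfin.toFinset (hfin.subset hSV)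
      (fun x hx => hGS.exists_isEar (hmem hx).1)
      (fun x hx y hy hxy => hGS.indep x (hmem hx).1 y (hmem hy).1 hxy.2)
      (fun h => hGS.induce_free ((G.hasK4Minor_induce_iff S).2 h)) (fun x hx y hy h => ?_)
      ((hdel.1 hK).mono_set fun w hw => ?_)
    · by_cases hxy : x = y
      · refine hGS.single_free x (hmem hx).1 ((G.hasK4Minor_induce_iff _).2 (h.mono_set ?_))
        grind
      · have hadj : (G.auxGraph S).Adj ⟨x, (hmem hx).1⟩ ⟨y, (hmem hy).1⟩ :=
          ⟨fun h => hxy (congrArg Subtype.val h),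
            (G.hasK4Minor_induce_iff _).2 (h.mono_set (by grind))⟩
        exact (hcov hadj).elim (hmem hx).2 (hmem hy).2
    · by_cases hwS : w ∈ S
      · exact Or.inl hwS
      · exact Or.inr (hEfin.mem_toFinset.2 ⟨⟨hw.1, hwS⟩, hw.2⟩)
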